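/- Let $G=(V,E)$ be a finite connected undirected graph with source set $\emptyset\neq S\subsetneq V$, neighbourhoods $\mathcal N(i)$ and symmetric edge weights $w_{ij}=w_{ji}>0$. Let $x_i$ be the length of a shortest path from $i$ to $S$, so that $x_i=0$ for $i\in S$ and $x_i=\min_{j\in\mathcal N(i)}\{x_j+w_{ij}\}$ for $i\notin S$. Let $\mathcal P(i)$ be the set of minimizing $j$ if $i\notin S$ and $\mathcal P(i)=\emptyset$ if $i\in S$ (the true parents of $i$). Let $\zeta\in(0,1)$ be such that $$\frac{x_i}{x_l+w_{il}}\le\zeta\qquad\text{for all } i\in V,\ l\in\mathcal N(i)\setminus\mathcal P(i).$$ Let $\eta$ be a constant gain with $1<\eta<1/\zeta$. The distributed biased min-consensus protocol (DBMC) with perturbed weights is $$\dot x_i(t)=0\ (i\in S),\qquad \dot x_i(t)=-\eta\Big(x_i(t)-\min_{j\in\mathcal N(i)}\{x_j(t)+w_{ij}(t)\}\Big)\ (i\notin S).$$ With $e_i(t)=x_i(t)-x_i$ and $u_{ij}(t)=w_{ij}(t)-w_{ij}$ ($i\in V$, $j\in\mathcal N(i)$), write it as $\dot e(t)=F(e(t),u(t))$,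 where solutions are continuous and satisfy the integral form of the equation. Let $X$ be the set of all $e\in\mathbb R^V$ with $x_i+e_i\ge0$ for all $i$ and $x_i+e_i=0$ for $i\in S$ (non-negative states, with the sources at $0$). Let $U$ be the set of all measurable $u$ for which there are constants $0<w_{\min}\le w_{\max}$ with $w_{\min}\le w_{ij}+u_{ij}(t)\le w_{\max}$ for all $t\ge0$, $i\in V$, $j\in\mathcal N(i)$; asymmetric perturbations are allowed. Fix arbitrary norms on the state space and on the space of input values that are monotone in the absolute values of the coordinates, and put $\|u\|_\infty=\sup_{t\ge0}\|u(t)\|$. Then: 1. There are $\sigma_i>0$ ($i\in V$) such that $W(e)=\max_{i\in V}\sigma_i^{-1}|e_i|$ is an exponential ISS Lyapunov function for $\dot e=F(e,u)$ on $X$ with inputs in $U$: $W$ is continuous and non-negative, and there are constants $\underline\omega,\bar\omega,b,\kappa>0$ and $\chi\in\mathcal K_\infty$ such that $\underline\omega\|e\|^b\le W(e)\le\bar\omega\|e\|^b$ for all $e\in\mathbb R^V$, and for all $e\in X$ and $u\in U$, $$W(e)\ge\chi(\|u\|_\infty)\ \Longrightarrow\ \langle\xi,F(e,u(t))\rangle\le-\kappa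 W(e)\quad\text{for all } t\ge0 \text{ and } \xi\in\partial W(e),$$ where $\partial W(e)$ is Clarke's generalized gradient, that is, the convex hull of all limits of $\nabla W(e_k)$ along sequences $e_k\to e$ of points at which $W$ is differentiable. 2. The system is globally exponentially input-to-state stable on $X$ with inputs in $U$: for all $e(0)\in X$ and $u\in U$ there is a unique solution on $[0,\infty)$, which stays in $X$, and there are $c,p>0$ and $\lambda_u\in\mathcal K$ such that for all $e(0)\in X$, $u\in U$ and $t\ge0$, $$\|e(t)\|\le c\,e^{-pt}\|e(0)\|+\lambda_u(\|u\|_\infty).$$ -/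

import Mathlib

open Set Filter Topology MeasureTheory

namespace DBMC

/-! ### Comparison functions and monotonic norms -/

/-- Class `K`: continuous, strictly increasing on `[0, ∞)`, zero at `0`. -/
def ClassK (α : ℝ → ℝ) : Prop :=
  ContinuousOn α (Ici 0) ∧ StrictMonoOn α (Ici 0) ∧ α 0 = 0

/-- Class `K_∞`: class `K` and unbounded. -/
def ClassKInf (α : ℝ → ℝ) : Prop :=
  ClassK α ∧ Tendsto α atTop atTop

/-- `N` is a norm on `ℝ^ι` which is monotone in the absolute values of the coordinates. -/
def IsMonotonicNorm {ι : Type*} (N : Seminorm ℝ (ι → ℝ)) : Prop :=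
  (∀ x, N x = 0 → x = 0) ∧ ∀ x y : ι → ℝ, (∀ i, |x i| ≤ |y i|) → N x ≤ N y

/-- The sup-norm `sup {N (u t) : t ≥ 0}` of a signal on `[0, ∞)`. -/
noncomputable def supNorm {κ : Type*} (N : Seminorm ℝ (κ → ℝ)) (u : ℝ → κ → ℝ) : ℝ :=
  ⨆ t : Ici (0 : ℝ), N (u t)

/-! ### Systems `ė = F(e, u)` with state space `ℝ^ι` and input values in `ℝ^κ` -/

/-- (Carathéodory) solution of `ė(t) = F(e(t), u(t))` on `[0, ∞)`: a continuous curve that satisfies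
the integral equation. If `u` and `F` are continuous, this is a classical `C¹` solution. -/
def IsSolution {ι κ : Type*} [Fintype ι] (F : (ι → ℝ) → (κ → ℝ) → ι → ℝ)
    (u : ℝ → κ → ℝ) (e : ℝ → ι → ℝ) : Prop :=
  ContinuousOn e (Ici 0) ∧ ∀ t, 0 ≤ t →
    IntervalIntegrable (fun s => F (e s) (u s)) volume 0 t ∧
      e t = e 0 + ∫ s in (0 : ℝ)..t, F (e s) (u s)

/-- Clarke's generalized gradient: the convex hull of all limits of derivatives `dV/dx (x_k)` along
sequences `x_k → x` of points of differentiability. Its elements `ξ` are regarded as linear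
functionals, so that `⟨ξ, v⟩` is `ξ v`. -/
def clarkeGradient {ι : Type*} [Fintype ι] (V : (ι → ℝ) → ℝ) (x : ι → ℝ) :
    Set ((ι → ℝ) →L[ℝ] ℝ) :=
  convexHull ℝ {ξ | ∃ y : ℕ → ι → ℝ, Tendsto y atTop (𝓝 x) ∧
    (∀ k, DifferentiableAt ℝ V (y k)) ∧ Tendsto (fun k => fderiv ℝ V (y k)) atTop (𝓝 ξ)}

/-- `V` is an (implication-form) exponential ISS Lyapunov function for `ė = F(e, u)` with
states in `X` and input signals in `U`. -/
def IsEISSLyapunov {ι κ : Type*} [Fintype ι] (NX : Seminorm ℝ (ι → ℝ)) (NU : Seminorm ℝ (κ → ℝ))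
    (F : (ι → ℝ) → (κ → ℝ) → ι → ℝ) (X : Set (ι → ℝ)) (U : Set (ℝ → κ → ℝ))
    (V : (ι → ℝ) → ℝ) : Prop :=
  Continuous V ∧ (∀ x, 0 ≤ V x) ∧
    ∃ ωl ωu b k : ℝ, 0 < ωl ∧ 0 < ωu ∧ 0 < b ∧ 0 < k ∧
      (∀ x, ωl * NX x ^ b ≤ V x ∧ V x ≤ ωu * NX x ^ b) ∧
      ∃ χ : ℝ → ℝ, ClassKInf χ ∧
        ∀ x ∈ X, ∀ u ∈ U, χ (supNorm NU u) ≤ V x →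
          ∀ t, 0 ≤ t → ∀ ξ ∈ clarkeGradient V x, ξ (F x (u t)) ≤ -k * V x

/-- Forward completeness for initial states in `X` and inputs in `U`: the solution exists on
`[0, ∞)`, it is unique there, and it remains in `X`. -/
def ForwardComplete {ι κ : Type*} [Fintype ι] (F : (ι → ℝ) → (κ → ℝ) → ι → ℝ)
    (X : Set (ι → ℝ)) (U : Set (ℝ → κ → ℝ)) : Prop :=
  ∀ e₀ ∈ X, ∀ u ∈ U, ∃ e : ℝ → ι → ℝ,
    IsSolution F u e ∧ e 0 = e₀ ∧ (∀ t, 0 ≤ t → e t ∈ X) ∧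
      ∀ e' : ℝ → ι → ℝ, IsSolution F u e' → e' 0 = e₀ → EqOn e' e (Ici 0)

/-- Global exponential input-to-state stability of `ė = F(e, u)` with states in `X` and input
signals in `U`. -/
def IsExpISS {ι κ : Type*} [Fintype ι] (NX : Seminorm ℝ (ι → ℝ)) (NU : Seminorm ℝ (κ → ℝ))
    (F : (ι → ℝ) → (κ → ℝ) → ι → ℝ) (X : Set (ι → ℝ)) (U : Set (ℝ → κ → ℝ)) : Prop :=
  ForwardComplete F X U ∧
    ∃ c p : ℝ, 0 < c ∧ 0 < p ∧ ∃ γ : ℝ → ℝ, ClassK γ ∧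
      ∀ u ∈ U, ∀ e : ℝ → ι → ℝ, IsSolution F u e → e 0 ∈ X →
        ∀ t, 0 ≤ t → NX (e t) ≤ c * Real.exp (-p * t) * NX (e 0) + γ (supNorm NU u)

/-! ### Shortest paths and the distributed biased min-consensus protocol

Edge weights are functions on the darts (oriented edges) of the graph: the value at the dart
`(i, j)` is `w_ij`. There are exactly `2|E|` darts. -/

section

variable {V : Type*} (G : SimpleGraph V)

/-- Length of the shortest path from `i` to the source set `S`: the least total weight of a walk from
`i` to `S`. (For positive weights, removing cycles from a walk makes it shorter, so walks and paths
give the same value.) -/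
noncomputable def dist (w : G.Dart → ℝ) (S : Set V) (i : V) : ℝ :=
  sInf {r : ℝ | ∃ s ∈ S, ∃ p : G.Walk i s, r = (p.darts.map w).sum}

/-- `min_{j ∈ N(i)} (x_j + w_ij)`. -/
noncomputable def nbrMin (w : G.Dart → ℝ) (x : V → ℝ) (i : V) : ℝ :=
  ⨅ j : G.neighborSet i, (x j + w ⟨(i, j), j.2⟩)

/-- The set `P(i)` of true parent nodes of `i`: the minimizers `j ∈ N(i)` of `x_j + w_ij`, where `x`
is the distance to the sources; empty if `i` is a source. -/
def trueParents (w : G.Dart → ℝ) (S : Set V) (i : V) : Set V :=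
  {j | i ∉ S ∧ ∃ h : G.Adj i j, dist G w S j + w ⟨(i, j), h⟩ = nbrMin G w (dist G w S) i}

open Classical in
/-- Right-hand side of the protocol with gain `η` and current edge weights `W`. -/
noncomputable def protocol (S : Set V) (η : ℝ) (W : G.Dart → ℝ) (x : V → ℝ) : V → ℝ :=
  fun i => if i ∈ S then 0 else -η * (x i - nbrMin G W x i)

/-- The error system `ė = F(e, u)`: the protocol at the state `x_i(t) = x_i + e_i(t)` with the
edge weights `w_ij(t) = w_ij + u_ij(t)`. -/
noncomputable def errorField (w : G.Dart → ℝ) (S : Set V) (η : ℝ) (e : V → ℝ) (u : G.Dart → ℝ) :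
    V → ℝ :=
  protocol G S η (w + u) (dist G w S + e)

/-- State errors of the non-negative states in which all sources are at `0`. -/
def errorStates (w : G.Dart → ℝ) (S : Set V) : Set (V → ℝ) :=
  {e | (∀ i, 0 ≤ dist G w S i + e i) ∧ ∀ i ∈ S, dist G w S i + e i = 0}

/-- Edge-weight deviations `u_ij(t) = w_ij(t) - w_ij` of measurable, not necessarily symmetric,
perturbed weights with `0 < w_min ≤ w_ij(t) ≤ w_max` for all `t ≥ 0`. -/
def weightDeviations (w : G.Dart → ℝ) : Set (ℝ → G.Dart → ℝ) :=
  {u | Measurable u ∧ ∃ wmin wmax : ℝ, 0 < wmin ∧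
    ∀ t, 0 ≤ t → ∀ d : G.Dart, wmin ≤ w d + u t d ∧ w d + u t d ≤ wmax}

end

end DBMC

/-! The field equals `η • (relax e u - e)`, where `relax` performs one Bellman update at every
non-source node. Everything rests on a contraction estimate for this update (`abs_relax_le`): if `σ`
increases strictly with the distance to `S` and takes values in `[1, 1/ζ)` (`exists_scaling`), then
on `errorStates` the weighted maximum `M e = max σ_i⁻¹ |e_i|` satisfies `M (relax e u) ≤ ρ * M e +
D` with `ρ < 1` and `D` proportional to the input. True parents are closer to `S` and so have
smaller weight. Other neighbours may have larger weight, but the slack that `ζ` guarantees, together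
with non-negativity of the states, prevents them from lowering the minimum too far.

Since `M` is convex, Clarke gradients are subgradients, and testing one at `relax e u` yields `⟨ξ,
F⟩ ≤ η (M (relax e u) - M e)`, the Lyapunov decay.

For trajectories, `sublinear_le_gronwallBound` turns such an estimate into a Grönwall bound for any
continuous sublinear function. It serves three times: with the norm for uniqueness, with the largest
negative part for invariance of the non-negative states, and with `M` for the ISS estimate.
Existence is a Picard fixed point in an exponentially weighted sup-norm. -/

namespace DBMC

/-! ### Comparison principle for sublinear functions along integral solutions -/

section Sublinear

variable {E : Type*} [NormedAddCommGroup E] [NormedSpace ℝ E] {M : E → ℝ}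

lemma convexOn_of_sublinear (hadd : ∀ x y, M (x + y) ≤ M x + M y)
    (hsmul : ∀ c : ℝ, 0 ≤ c → ∀ x, M (c • x) = c * M x) : ConvexOn ℝ univ M :=
  ⟨convex_univ, fun x _ y _ a b ha hb _ => by
    simpa only [hsmul a ha, hsmul b hb, smul_eq_mul] using hadd (a • x) (b • y)⟩

/-- Comparison principle: if `ė = η (T - e)` in the integral sense and the sublinear function `M`
satisfies `M (T t) ≤ ρ M (e t) + D`, then `M ∘ e` obeys the corresponding Grönwall bound. -/
theorem sublinear_le_gronwallBound [CompleteSpace E] (hM : Continuous M)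
    (hadd : ∀ x y, M (x + y) ≤ M x + M y)
    (hsmul : ∀ c : ℝ, 0 ≤ c → ∀ x, M (c • x) = c * M x)
    {η ρ D : ℝ} (hη : 0 < η) {e T : ℝ → E} (he : ContinuousOn e (Ici 0))
    (hint : ∀ t, 0 ≤ t → IntervalIntegrable (fun s => η • (T s - e s)) volume 0 t)
    (heq : ∀ t, 0 ≤ t → e t = e 0 + ∫ s in (0 : ℝ)..t, η • (T s - e s))
    (hT : ∀ t, 0 ≤ t → M (T t) ≤ ρ * M (e t) + D) {t : ℝ} (ht : 0 ≤ t) :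
    M (e t) ≤ gronwallBound (M (e 0)) (-(η * (1 - ρ))) (η * D) t := by
  have hM0 : M 0 = 0 := by simpa using hsmul 0 le_rfl 0
  have hMe : ContinuousOn (fun s => M (e s)) (Ici 0) := hM.comp_continuousOn he
  suffices H : ∀ x ∈ Icc 0 t, M (e x) ≤
      gronwallBound (M (e 0)) (-(η * (1 - ρ))) (η * D) (x - 0) by
    simpa using H t ⟨ht, le_rfl⟩
  refine le_gronwallBound_of_liminf_deriv_right_le (f := fun s => M (e s))
    (f' := fun s => -(η * (1 - ρ)) * M (e s) + η * D)
    (hMe.mono Icc_subset_Ici_self) ?_ le_rfl (fun _ _ => le_rfl)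
  intro s hs r hr
  have hs0 : (0 : ℝ) ≤ s := hs.1
  refine Eventually.frequently ?_
  -- The gap between `r` and the target slope is `2 * η * δ`: half is spent on replacing `e q` by `e
  -- s`, half keeps the final inequality strict.
  set δ : ℝ := (r - (-(η * (1 - ρ)) * M (e s) + η * D)) / (2 * η) with hδ
  have hδ0 : 0 < δ := div_pos (by linarith) (by linarith)
  have hηδ : 2 * (η * δ) = r - (-(η * (1 - ρ)) * M (e s) + η * D) := by
    rw [hδ]; field_simp
  set c : ℝ := ρ * M (e s) + D + δ with hc
  have hcont : ContinuousWithinAt (fun q => ρ * M (e q) + D + M (e s - e q)) (Ici 0) s := by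
    have h1 := hMe s hs0
    have h2 : ContinuousWithinAt (fun q => M (e s - e q)) (Ici 0) s :=
      hM.continuousAt.comp_continuousWithinAt (continuousWithinAt_const.sub (he s hs0))
    exact ((h1.const_mul ρ).add_const D).add h2
  have hev : ∀ᶠ q in 𝓝[≥] s, ρ * M (e q) + D + M (e s - e q) < c := by
    refine (hcont.mono (Ici_subset_Ici.2 hs0)).eventually_lt_const ?_
    simp only [sub_self, hM0, hc]; linarith
  obtain ⟨v, hv, hvsub⟩ := (mem_nhdsGE_iff_exists_Ico_subset).1 hev
  -- The cap `s + η⁻¹` makes `1 - η * (z - s)` non-negative, so that `e z` is a convex combination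
  -- of `e s` and the average below.
  have hv' : s < min v (s + η⁻¹) := lt_min hv (by have := inv_pos.2 hη; linarith)
  filter_upwards [Ioo_mem_nhdsGT hv'] with z hz
  have hsz : s < z := hz.1
  have hzv : z < v := hz.2.trans_le (min_le_left _ _)
  have hzη : z - s < η⁻¹ := by have := hz.2.trans_le (min_le_right v (s + η⁻¹)); linarith
  have hz0 : 0 ≤ z := hs0.trans hsz.le
  have hint' : IntervalIntegrable (fun q => η • (T q - e q)) volume s z :=
    (hint s hs0).symm.trans (hint z hz0)
  have hint'' : IntervalIntegrable (fun q => T q - e q) volume s z := by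
    refine (hint'.smul η⁻¹).congr fun q _ => ?_
    simp [smul_smul, inv_mul_cancel₀ hη.ne']
  have hdiff : e z - e s = η • ∫ q in s..z, (T q - e q) := by
    rw [heq z hz0, heq s hs0, add_sub_add_left_eq_sub,
      intervalIntegral.integral_interval_sub_left (hint z hz0) (hint s hs0),
      intervalIntegral.integral_smul]
  -- The average of values in a closed convex sublevel set stays in it. This replaces
  -- differentiation of `e` and of `M`.
  have hmem : (⨍ q in s..z, ((T q - e q) + e s)) ∈ {x | M x ≤ c} := by
    have hconv : Convex ℝ {x | M x ≤ c} := by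
      simpa using (convexOn_of_sublinear hadd hsmul).convex_le c
    refine hconv.set_average_mem (isClosed_le hM continuous_const) ?_ ?_ ?_ ?_
    · simp [uIoc_of_le hsz.le, hsz]
    · simp [uIoc_of_le hsz.le]
    · refine (ae_restrict_iff' measurableSet_uIoc).2 (Eventually.of_forall fun q hq => ?_)
      rw [uIoc_of_le hsz.le] at hq
      have hq0 : 0 ≤ q := hs0.trans hq.1.le
      have h1 : ρ * M (e q) + D + M (e s - e q) < c := hvsub ⟨hq.1.le, hq.2.trans_lt hzv⟩
      have h2 := hadd (T q) (e s - e q)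
      have h3 := hT q hq0
      have h4 : T q - e q + e s = T q + (e s - e q) := by abel
      simp only [mem_ofPred_eq, h4]
      linarith
    · exact (intervalIntegrable_iff.1 (hint''.add intervalIntegrable_const))
  have havg : η • (z - s) • (⨍ q in s..z, ((T q - e q) + e s)) =
      (e z - e s) + (η * (z - s)) • e s := by
    rw [interval_average_eq, smul_smul (z - s), mul_inv_cancel₀ (sub_pos.2 hsz).ne', one_smul,
      intervalIntegral.integral_add hint'' intervalIntegrable_const, smul_add, ← hdiff,
      intervalIntegral.integral_const, smul_smul]
  set a := ⨍ q in s..z, ((T q - e q) + e s)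
  have hh0 : 0 ≤ η * (z - s) := mul_nonneg hη.le (by linarith)
  have hh1 : 0 ≤ 1 - η * (z - s) := by
    have := mul_le_mul_of_nonneg_left hzη.le hη.le
    rw [mul_inv_cancel₀ hη.ne'] at this; linarith
  have hez : e z = (1 - η * (z - s)) • e s + (η * (z - s)) • a := by
    rw [smul_smul] at havg
    rw [havg, sub_smul, one_smul]; abel
  have hbound : M (e z) ≤ (1 - η * (z - s)) * M (e s) + η * (z - s) * c := by
    rw [hez]
    refine (hadd _ _).trans ?_
    rw [hsmul _ hh1, hsmul _ hh0]
    have : M a ≤ c := hmem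
    gcongr
  rw [inv_mul_lt_iff₀ (sub_pos.2 hsz)]
  have h5 : M (e z) - M (e s) ≤ (z - s) * (η * (c - M (e s))) := by linarith
  refine h5.trans_lt (mul_lt_mul_of_pos_left ?_ (sub_pos.2 hsz))
  have h6 : η * (c - M (e s)) = -(η * (1 - ρ)) * M (e s) + η * D + η * δ := by rw [hc]; ring
  have := mul_pos hη hδ0
  linarith

end Sublinear

/-! ### Clarke gradients of convex functions -/

section Clarke

variable {ι : Type*} [Fintype ι]

/-- Elements of Clarke's generalized gradient of a continuous convex function are subgradients. -/
lemma apply_sub_le_of_mem_clarkeGradient {M : (ι → ℝ) → ℝ} (hM : Continuous M)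
    (hconv : ConvexOn ℝ univ M) {x : ι → ℝ} {ξ : (ι → ℝ) →L[ℝ] ℝ} (hξ : ξ ∈ clarkeGradient M x)
    (y : ι → ℝ) : ξ (y - x) ≤ M y - M x := by
  let C : Set ((ι → ℝ) →L[ℝ] ℝ) := {ξ | ξ (y - x) ≤ M y - M x}
  have hC : Convex ℝ C := by
    intro a ha b hb p q hp hq hpq
    simp only [C, mem_ofPred_eq, add_apply, smul_apply,
      smul_eq_mul] at ha hb ⊢
    calc p * a (y - x) + q * b (y - x) ≤ p * (M y - M x) + q * (M y - M x) := by gcongr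
      _ = M y - M x := by rw [← add_mul, hpq, one_mul]
  refine convexHull_min (t := C) ?_ hC hξ
  rintro φ ⟨z, hz, hd, hφ⟩
  -- The subgradient inequality at `z k` is used in the fixed direction `y - x`, so only the base
  -- point moves in the limit. It holds because a convex function on a line has derivative at `0` at
  -- most its slope over `[0, 1]`.
  have hsub : ∀ k, fderiv ℝ M (z k) (y - x) ≤ M (z k + (y - x)) - M (z k) := by
    intro k
    have hg : ConvexOn ℝ univ (fun t : ℝ => M (AffineMap.lineMap (z k) (z k + (y - x)) t)) := by
      exact hconv.comp_affineMap (AffineMap.lineMap (k := ℝ) (z k) (z k + (y - x)))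
    have hder : HasDerivAt (fun t : ℝ => M (AffineMap.lineMap (z k) (z k + (y - x)) t))
        (fderiv ℝ M (z k) (y - x)) 0 := by
      have h1 : HasDerivAt (fun t : ℝ => (AffineMap.lineMap (z k) (z k + (y - x)) t : ι → ℝ))
          (y - x) 0 := by
        simpa using AffineMap.hasDerivAt_lineMap (𝕜 := ℝ) (a := z k) (b := z k + (y - x)) (x := 0)
      have h2 : HasFDerivAt M (fderiv ℝ M (z k))
          (AffineMap.lineMap (z k) (z k + (y - x)) (0 : ℝ)) := by
        simpa using (hd k).hasFDerivAt
      exact h2.comp_hasDerivAt 0 h1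
    have := hg.le_slope_of_hasDerivAt (mem_univ 0) (mem_univ 1) zero_lt_one hder
    simpa [slope_def_field] using this
  refine le_of_tendsto_of_tendsto' (f := fun k => fderiv ℝ M (z k) (y - x))
    (g := fun k => M (z k + (y - x)) - M (z k)) (b := atTop) ?_ ?_ hsub
  · exact ((ContinuousLinearMap.apply ℝ ℝ (y - x)).continuous.tendsto φ).comp hφ
  · have h1 : Tendsto (fun k => M (z k + (y - x))) atTop (𝓝 (M (x + (y - x)))) :=
      (hM.tendsto _).comp (hz.add_const _)
    have h2 := h1.sub ((hM.tendsto _).comp hz)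
    simpa using h2

end Clarke

/-! ### Monotonic norms and comparison functions -/

section Norms

variable {ι : Type*}

open Classical in
-- By monotonicity, `x i • Pi.single i 1` has norm at most `N x`; definiteness allows division by `N
-- (Pi.single i 1)`.
lemma IsMonotonicNorm.exists_abs_le [Fintype ι] {N : Seminorm ℝ (ι → ℝ)} (hN : IsMonotonicNorm N) :
    ∃ C : ℝ, 0 < C ∧ ∀ x i, |x i| ≤ C * N x := by
  have hpos : ∀ i : ι, 0 < N (Pi.single i 1) := fun i =>
    lt_of_le_of_ne (apply_nonneg N _) fun h => by
      have := congrFun (hN.1 _ h.symm) i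
      simp at this
  have hle : ∀ (x : ι → ℝ) i, |x i| * N (Pi.single i 1) ≤ N x := by
    intro x i
    have : |x i| * N (Pi.single i 1) = N (x i • Pi.single i 1) := by
      rw [map_smul_eq_mul, Real.norm_eq_abs]
    rw [this]
    refine hN.2 _ _ fun j => ?_
    by_cases h : j = i
    · subst h; simp
    · simp [h]
  have hinv : ∀ i, 0 ≤ (N (Pi.single i 1))⁻¹ := fun i => (inv_pos.2 (hpos i)).le
  refine ⟨∑ i, (N (Pi.single i 1))⁻¹ + 1,
    add_pos_of_nonneg_of_pos (Finset.sum_nonneg fun i _ => hinv i) one_pos, fun x i => ?_⟩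
  have h1 : |x i| ≤ (N (Pi.single i 1))⁻¹ * N x := by
    rw [← div_eq_inv_mul, le_div_iff₀ (hpos i)]; exact hle x i
  refine h1.trans (mul_le_mul_of_nonneg_right ?_ (apply_nonneg N x))
  have := Finset.single_le_sum (f := fun i => (N (Pi.single i 1))⁻¹) (fun i _ => hinv i)
    (Finset.mem_univ i)
  linarith

lemma IsMonotonicNorm.le_supNorm {N : Seminorm ℝ (ι → ℝ)} (hN : IsMonotonicNorm N)
    {u : ℝ → ι → ℝ} {B : ℝ} (hB : ∀ t, 0 ≤ t → ∀ i, |u t i| ≤ B) {t : ℝ} (ht : 0 ≤ t) :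
    N (u t) ≤ supNorm N u := by
  refine le_ciSup (f := fun t : Ici (0 : ℝ) => N (u t)) ⟨N (fun _ => B), ?_⟩ ⟨t, ht⟩
  rintro _ ⟨s, rfl⟩
  exact hN.2 _ _ fun i => (hB s s.2 i).trans (le_abs_self B)

lemma supNorm_nonneg (N : Seminorm ℝ (ι → ℝ)) (u : ℝ → ι → ℝ) : 0 ≤ supNorm N u :=
  Real.iSup_nonneg fun _ => apply_nonneg N _

lemma classKInf_const_mul {c : ℝ} (hc : 0 < c) : ClassKInf (fun r => c * r) :=
  ⟨⟨by fun_prop, fun _ _ _ _ h => mul_lt_mul_of_pos_left h hc, mul_zero c⟩,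
    tendsto_id.const_mul_atTop hc⟩

end Norms

end DBMC

namespace DBMC

/-! ### Global existence of Carathéodory solutions -/

section Existence

variable {E : Type*} [NormedAddCommGroup E] [NormedSpace ℝ E]

/-- In the norm weighted by `exp (-L t)`, integration gains a factor `1 / L`; this makes the Picard
map contract on the whole half-line at once. -/
lemma norm_exp_smul_integral_le {h : ℝ → E} {A L τ : ℝ} (hL : 0 < L) (hA : 0 ≤ A) (hτ : 0 ≤ τ)
    (hh : ∀ s, 0 ≤ s → ‖h s‖ ≤ A * Real.exp (L * s)) :
    ‖Real.exp (-(L * τ)) • ∫ s in (0 : ℝ)..τ, h s‖ ≤ A / L := by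
  have h1 : ‖∫ s in (0 : ℝ)..τ, h s‖ ≤ ∫ s in (0 : ℝ)..τ, A * Real.exp (L * s) :=
    intervalIntegral.norm_integral_le_of_norm_le hτ
      (Eventually.of_forall fun s hs => hh s hs.1.le)
      (Continuous.intervalIntegrable (by fun_prop) _ _)
  have h2 : ∫ s in (0 : ℝ)..τ, A * Real.exp (L * s) =
      A / L * Real.exp (L * τ) - A / L * Real.exp (L * 0) := by
    refine intervalIntegral.integral_eq_sub_of_hasDerivAt
      (f := fun s => A / L * Real.exp (L * s)) (fun s _ => ?_)
      (Continuous.intervalIntegrable (by fun_prop) _ _)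
    have := (((hasDerivAt_id s).const_mul L).exp).const_mul (A / L)
    refine this.congr_deriv ?_
    simp only [id, mul_one]
    field_simp
  have h3 : ‖∫ s in (0 : ℝ)..τ, h s‖ ≤ A / L * Real.exp (L * τ) := by
    refine h1.trans (h2.le.trans ?_)
    have : 0 ≤ A / L * Real.exp (L * 0) := by positivity
    linarith
  rw [norm_smul, Real.norm_eq_abs, abs_of_pos (Real.exp_pos _)]
  calc Real.exp (-(L * τ)) * ‖∫ s in (0 : ℝ)..τ, h s‖
      ≤ Real.exp (-(L * τ)) * (A / L * Real.exp (L * τ)) := by gcongr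
    _ = A / L * (Real.exp (-(L * τ)) * Real.exp (L * τ)) := by ring
    _ = A / L := by rw [← Real.exp_add]; simp

/-- Global existence of Carathéodory solutions of `ė(t) = f(t, e(t))` for a right-hand side which is
uniformly Lipschitz in the state and bounded along the zero state. -/
theorem exists_integral_solution [CompleteSpace E] {f : ℝ → E → E} {K B : ℝ} (hK : 0 < K)
    (hmeas : ∀ e : ℝ → E, Continuous e → AEStronglyMeasurable (fun s => f s (e s)) volume)
    (hlip : ∀ s x y, ‖f s x - f s y‖ ≤ K * ‖x - y‖) (hB : ∀ s, ‖f s 0‖ ≤ B) (e₀ : E) :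
    ∃ e : ℝ → E, Continuous e ∧ ∀ t, 0 ≤ t → IntervalIntegrable (fun s => f s (e s)) volume 0 t ∧
      e t = e₀ + ∫ s in (0 : ℝ)..t, f s (e s) := by
  have hB0 : 0 ≤ B := (norm_nonneg _).trans (hB 0)
  have hgrowth : ∀ s x, ‖f s x‖ ≤ K * ‖x‖ + B := by
    intro s x
    have h1 := hlip s x 0
    have h2 := norm_add_le (f s x - f s 0) (f s 0)
    rw [sub_add_cancel] at h2
    rw [sub_zero] at h1
    linarith [hB s]
  have hint : ∀ e : ℝ → E, Continuous e → ∀ a b,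
      IntervalIntegrable (fun s => f s (e s)) volume a b := by
    intro e he a b
    have hdom : IntervalIntegrable (fun s => K * ‖e s‖ + B) volume a b :=
      Continuous.intervalIntegrable (by fun_prop) _ _
    exact hdom.mono_fun' (hmeas e he).restrict (Eventually.of_forall fun s => hgrowth s (e s))
  -- With `L = 2 * K` the Picard map has Lipschitz constant `K / L = 1 / 2`.
  set L : ℝ := 2 * K with hLdef
  have hL : 0 < L := by positivity
  -- The unknown is the rescaled curve `y s = exp (-L s) • e s`, which stays bounded; `sc` undoes
  -- the scaling. Freezing time at `max t 0` keeps the map within bounded functions on all of `ℝ`.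
  let sc : BoundedContinuousFunction ℝ E → ℝ → E := fun y s => Real.exp (L * s) • y s
  have hsc : ∀ y, Continuous (sc y) := fun y => by
    have := y.continuous
    fun_prop
  let Φ₀ : BoundedContinuousFunction ℝ E → ℝ → E := fun y t =>
    Real.exp (-(L * max t 0)) • e₀ +
      Real.exp (-(L * max t 0)) • ∫ s in (0 : ℝ)..(max t 0), f s (sc y s)
  have hΦc : ∀ y, Continuous (Φ₀ y) := fun y => by
    have h1 : Continuous fun b => ∫ s in (0 : ℝ)..b, f s (sc y s) :=
      intervalIntegral.continuous_primitive (hint _ (hsc y)) 0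
    have h2 : Continuous fun t : ℝ => ∫ s in (0 : ℝ)..(max t 0), f s (sc y s) :=
      h1.comp (by fun_prop)
    fun_prop
  have hΦb : ∀ y t, ‖Φ₀ y t‖ ≤ ‖e₀‖ + (K * ‖y‖ + B) / L := by
    intro y t
    have ht : 0 ≤ max t 0 := le_max_right _ _
    refine (norm_add_le _ _).trans (add_le_add ?_ ?_)
    · rw [norm_smul, Real.norm_eq_abs, abs_of_pos (Real.exp_pos _)]
      refine mul_le_of_le_one_left (norm_nonneg _) (Real.exp_le_one_iff.2 ?_)
      have := mul_nonneg hL.le ht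
      linarith
    · refine norm_exp_smul_integral_le hL (by positivity) ht fun s hs => ?_
      have h1 : (1 : ℝ) ≤ Real.exp (L * s) := Real.one_le_exp (by positivity)
      have h2 : ‖sc y s‖ ≤ Real.exp (L * s) * ‖y‖ := by
        simp only [sc, norm_smul, Real.norm_eq_abs, abs_of_pos (Real.exp_pos _)]
        gcongr
        exact y.norm_coe_le_norm s
      calc ‖f s (sc y s)‖ ≤ K * ‖sc y s‖ + B := hgrowth _ _
        _ ≤ K * (Real.exp (L * s) * ‖y‖) + B * Real.exp (L * s) := by
          gcongr
          exact le_mul_of_one_le_right hB0 h1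
        _ = (K * ‖y‖ + B) * Real.exp (L * s) := by ring
  let Φ : BoundedContinuousFunction ℝ E → BoundedContinuousFunction ℝ E := fun y =>
    BoundedContinuousFunction.ofNormedAddCommGroup (Φ₀ y) (hΦc y) _ (hΦb y)
  have hcontr : ContractingWith (1 / 2 : NNReal) Φ := by
    refine ⟨by norm_num, LipschitzWith.of_dist_le_mul fun y z => ?_⟩
    refine (BoundedContinuousFunction.dist_le (by positivity)).2 fun t => ?_
    have ht : 0 ≤ max t 0 := le_max_right _ _
    have hyz : Φ y t - Φ z t = Real.exp (-(L * max t 0)) •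
        ∫ s in (0 : ℝ)..(max t 0), (f s (sc y s) - f s (sc z s)) := by
      rw [intervalIntegral.integral_sub (hint _ (hsc y) _ _) (hint _ (hsc z) _ _), smul_sub]
      exact add_sub_add_left_eq_sub _ _ _
    rw [dist_eq_norm, hyz]
    have := norm_exp_smul_integral_le (h := fun s => f s (sc y s) - f s (sc z s))
      (A := K * ‖y - z‖) hL (by positivity) ht fun s hs => by
        refine (hlip _ _ _).trans ?_
        have h2 : ‖sc y s - sc z s‖ ≤ Real.exp (L * s) * ‖y - z‖ := by
          simp only [sc, ← smul_sub, norm_smul, Real.norm_eq_abs, abs_of_pos (Real.exp_pos _)]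
          gcongr
          exact (y - z).norm_coe_le_norm s
        calc K * ‖sc y s - sc z s‖ ≤ K * (Real.exp (L * s) * ‖y - z‖) := by gcongr
          _ = K * ‖y - z‖ * Real.exp (L * s) := by ring
    refine this.trans (le_of_eq ?_)
    rw [dist_eq_norm, hLdef]
    push_cast
    field_simp
  let y := ContractingWith.fixedPoint Φ hcontr
  have hy : Φ y = y := hcontr.fixedPoint_isFixedPt
  refine ⟨sc y, hsc y, fun t ht => ⟨hint _ (hsc y) _ _, ?_⟩⟩
  have h1 : y t = Φ₀ y t := (DFunLike.congr_fun hy t).symm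
  simp only [Φ₀, max_eq_left ht, ← smul_add] at h1
  change Real.exp (L * t) • y t = _
  rw [h1, smul_smul, ← Real.exp_add]
  simp

end Existence

/-! ### Distances to the sources and the Bellman equation -/

section Distance

variable {V : Type*} {G : SimpleGraph V} {w : G.Dart → ℝ} {S : Set V}

lemma walk_sum_nonneg (hw : ∀ d, 0 < w d) {i j : V} (p : G.Walk i j) :
    0 ≤ (p.darts.map w).sum :=
  List.sum_nonneg fun _ hx => by
    obtain ⟨d, _, rfl⟩ := List.mem_map.1 hx
    exact (hw d).le

lemma dist_le_walk (hw : ∀ d, 0 < w d) {i s : V} (hs : s ∈ S) (p : G.Walk i s) :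
    dist G w S i ≤ (p.darts.map w).sum :=
  csInf_le ⟨0, by rintro _ ⟨_, _, q, rfl⟩; exact walk_sum_nonneg hw q⟩ ⟨s, hs, p, rfl⟩

/-- Connectedness supplies a walk to `S`; without one the infimum would be the default value `0`. -/
lemma le_dist (hG : G.Connected) (hS : S.Nonempty) {i : V} {r : ℝ}
    (h : ∀ s ∈ S, ∀ p : G.Walk i s, r ≤ (p.darts.map w).sum) : r ≤ dist G w S i := by
  obtain ⟨s, hs⟩ := hS
  obtain ⟨p⟩ := hG.preconnected i s
  refine le_csInf ⟨_, s, hs, p, rfl⟩ ?_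
  rintro _ ⟨s', hs', q, rfl⟩
  exact h s' hs' q

lemma dist_nonneg (hw : ∀ d, 0 < w d) (i : V) : 0 ≤ dist G w S i :=
  Real.sInf_nonneg (by rintro _ ⟨_, _, q, rfl⟩; exact walk_sum_nonneg hw q)

lemma dist_source (hw : ∀ d, 0 < w d) {i : V} (hi : i ∈ S) : dist G w S i = 0 :=
  le_antisymm (by simpa using dist_le_walk hw hi (SimpleGraph.Walk.nil : G.Walk i i))
    (dist_nonneg hw i)

lemma dist_le_add (hG : G.Connected) (hS : S.Nonempty) (hw : ∀ d, 0 < w d) {i j : V}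
    (h : G.Adj i j) : dist G w S i ≤ dist G w S j + w ⟨(i, j), h⟩ := by
  rw [← sub_le_iff_le_add]
  refine le_dist hG hS fun s hs p => ?_
  have := dist_le_walk hw hs (SimpleGraph.Walk.cons h p)
  simp only [SimpleGraph.Walk.darts_cons, List.map_cons, List.sum_cons] at this
  linarith

lemma nonempty_neighborSet (hG : G.Connected) (hS : S.Nonempty) {i : V} (hi : i ∉ S) :
    Nonempty (G.neighborSet i) := by
  obtain ⟨s, hs⟩ := hS
  obtain ⟨p⟩ := hG.preconnected i s
  cases p with
  | nil => exact absurd hs hi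
  | cons h _ => exact ⟨⟨_, h⟩⟩

section Min

variable {W W' : G.Dart → ℝ} {x y : V → ℝ} {i : V}

lemma nbrMin_le [Finite V] (W : G.Dart → ℝ) (x : V → ℝ) {j : V} (h : G.Adj i j) :
    nbrMin G W x i ≤ x j + W ⟨(i, j), h⟩ :=
  ciInf_le (f := fun j : G.neighborSet i => x j + W ⟨(i, j), j.2⟩)
    (Set.finite_range _).bddBelow ⟨j, h⟩

lemma le_nbrMin (hi : Nonempty (G.neighborSet i)) {r : ℝ}
    (h : ∀ j (hj : G.Adj i j), r ≤ x j + W ⟨(i, j), hj⟩) : r ≤ nbrMin G W x i :=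
  le_ciInf fun j => h j j.2

lemma abs_nbrMin_sub_le [Finite V] {c : ℝ} (hc : 0 ≤ c)
    (h : ∀ j (hj : G.Adj i j), |(x j + W ⟨(i, j), hj⟩) - (y j + W' ⟨(i, j), hj⟩)| ≤ c) :
    |nbrMin G W x i - nbrMin G W' y i| ≤ c := by
  rcases isEmpty_or_nonempty (G.neighborSet i) with he | hne
  -- Over an empty neighbourhood both infima are `0` by default.
  · simpa [nbrMin, Real.iInf_of_isEmpty] using hc
  · rw [abs_sub_le_iff, sub_le_comm, sub_le_comm (a := nbrMin G W' y i)]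
    constructor <;> refine le_nbrMin hne fun j hj => ?_
    · have := nbrMin_le W x hj
      linarith [(abs_sub_le_iff.1 (h j hj)).1]
    · have := nbrMin_le W' y hj
      linarith [(abs_sub_le_iff.1 (h j hj)).2]

/-- The Bellman equation: a walk from `i ∉ S` to `S` has a first edge, and conversely an edge can be
prepended to any walk. -/
lemma nbrMin_dist [Finite V] (hG : G.Connected) (hS : S.Nonempty) (hw : ∀ d, 0 < w d) (hi : i ∉ S) :
    nbrMin G w (dist G w S) i = dist G w S i := by
  refine le_antisymm (le_dist hG hS fun s hs p => ?_)
    (le_nbrMin (nonempty_neighborSet hG hS hi) fun j hj => dist_le_add hG hS hw hj)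
  cases p with
  | nil => exact absurd hs hi
  | cons h q =>
    refine (nbrMin_le w _ h).trans ?_
    have := dist_le_walk hw hs q
    simp only [SimpleGraph.Walk.darts_cons, List.map_cons, List.sum_cons]
    linarith

lemma exists_dist_add_eq [Finite V] (hG : G.Connected) (hS : S.Nonempty) (hw : ∀ d, 0 < w d)
    (hi : i ∉ S) :
    ∃ j, ∃ h : G.Adj i j, dist G w S j + w ⟨(i, j), h⟩ = dist G w S i := by
  have := nonempty_neighborSet hG hS hi
  obtain ⟨j, hj⟩ := exists_eq_ciInf_of_finite
    (f := fun j : G.neighborSet i => dist G w S j + w ⟨(i, j), j.2⟩)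
  exact ⟨j, j.2, hj.trans (nbrMin_dist hG hS hw hi)⟩

end Min

end Distance

end DBMC

namespace DBMC

/-! ### Maxima of sublinear functions and the weighted sup-norm -/

section WeightedSup

variable {V : Type*} {m : V → (V → ℝ) → ℝ}

lemma continuous_iSup_of_fintype [Fintype V] [Nonempty V] (hm : ∀ i, Continuous (m i)) :
    Continuous fun x => ⨆ i, m i x := by
  simp_rw [← Finset.sup'_univ_eq_ciSup]
  exact Continuous.finset_sup'_apply _ fun i _ => hm i

lemma iSup_add_le [Fintype V] [Nonempty V] (hm : ∀ i x y, m i (x + y) ≤ m i x + m i y)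
    (x y : V → ℝ) :
    ⨆ i, m i (x + y) ≤ (⨆ i, m i x) + ⨆ i, m i y :=
  ciSup_le fun i => (hm i x y).trans (add_le_add
    (le_ciSup (f := fun i => m i x) (Set.finite_range _).bddAbove i)
    (le_ciSup (f := fun i => m i y) (Set.finite_range _).bddAbove i))

lemma iSup_smul (hm : ∀ i (c : ℝ), 0 ≤ c → ∀ x, m i (c • x) = c * m i x) (c : ℝ) (hc : 0 ≤ c)
    (x : V → ℝ) : ⨆ i, m i (c • x) = c * ⨆ i, m i x := by
  rw [Real.mul_iSup_of_nonneg hc]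
  exact iSup_congr fun i => hm i c hc x

variable {σ : V → ℝ}

lemma continuous_weightedSup [Fintype V] [Nonempty V] :
    Continuous fun e : V → ℝ => ⨆ i, (σ i)⁻¹ * |e i| :=
  continuous_iSup_of_fintype (m := fun i e => (σ i)⁻¹ * |e i|) fun i => by fun_prop

lemma weightedSup_add_le [Fintype V] [Nonempty V] (hσ : ∀ i, 0 < σ i) (x y : V → ℝ) :
    ⨆ i, (σ i)⁻¹ * |(x + y) i| ≤ (⨆ i, (σ i)⁻¹ * |x i|) + ⨆ i, (σ i)⁻¹ * |y i| :=
  iSup_add_le (m := fun i e => (σ i)⁻¹ * |e i|) (fun i x y => by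
    rw [← mul_add]
    exact mul_le_mul_of_nonneg_left (abs_add_le _ _) (inv_pos.2 (hσ i)).le) x y

lemma weightedSup_smul (c : ℝ) (hc : 0 ≤ c) (x : V → ℝ) :
    ⨆ i, (σ i)⁻¹ * |(c • x) i| = c * ⨆ i, (σ i)⁻¹ * |x i| :=
  iSup_smul (m := fun i e => (σ i)⁻¹ * |e i|) (fun i c hc x => by
    simp only [Pi.smul_apply, smul_eq_mul, abs_mul, abs_of_nonneg hc]; ring) c hc x

lemma weightedSup_nonneg (hσ : ∀ i, 0 < σ i) (x : V → ℝ) : 0 ≤ ⨆ i, (σ i)⁻¹ * |x i| :=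
  Real.iSup_nonneg fun i => mul_nonneg (inv_pos.2 (hσ i)).le (abs_nonneg _)

lemma abs_le_mul_weightedSup [Fintype V] (hσ : ∀ i, 0 < σ i) (x : V → ℝ) (i : V) :
    |x i| ≤ σ i * ⨆ i, (σ i)⁻¹ * |x i| := by
  have := le_ciSup (f := fun i => (σ i)⁻¹ * |x i|) (Set.finite_range _).bddAbove i
  rwa [inv_mul_le_iff₀ (hσ i)] at this

lemma weightedSup_le [Nonempty V] (hσ : ∀ i, 0 < σ i) {x : V → ℝ} {r : ℝ} (h : ∀ i, |x i| ≤ σ i * r) :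
    ⨆ i, (σ i)⁻¹ * |x i| ≤ r :=
  ciSup_le fun i => (inv_mul_le_iff₀ (hσ i)).2 (h i)

end WeightedSup

/-! ### The Bellman update as a weighted contraction -/

section Relax

variable {V : Type*} {G : SimpleGraph V} {w : G.Dart → ℝ} {S : Set V}

open Classical in
/-- State error after replacing every state `x_i`, `i ∉ S`, by `min_{j ∈ N(i)} (x_j + w_ij)`. -/
noncomputable def relax (G : SimpleGraph V) (w : G.Dart → ℝ) (S : Set V) (e : V → ℝ)
    (u : G.Dart → ℝ) : V → ℝ :=
  fun i => if i ∈ S then e i else nbrMin G (w + u) (dist G w S + e) i - dist G w S i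

lemma relax_source {e : V → ℝ} {u : G.Dart → ℝ} {i : V} (hi : i ∈ S) :
    relax G w S e u i = e i := if_pos hi

lemma relax_of_notMem {e : V → ℝ} {u : G.Dart → ℝ} {i : V} (hi : i ∉ S) :
    relax G w S e u i = nbrMin G (w + u) (dist G w S + e) i - dist G w S i := if_neg hi

lemma errorField_eq (η : ℝ) (e : V → ℝ) (u : G.Dart → ℝ) :
    errorField G w S η e u = η • (relax G w S e u - e) := by
  ext i
  by_cases hi : i ∈ S
  · simp [errorField, protocol, relax, hi]
  · simp only [errorField, protocol, relax, hi, if_false, Pi.smul_apply, Pi.sub_apply,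
      Pi.add_apply, smul_eq_mul]
    ring

lemma norm_relax_sub_le [Fintype V] (e e' : V → ℝ) (u : G.Dart → ℝ) :
    ‖relax G w S e u - relax G w S e' u‖ ≤ ‖e - e'‖ := by
  refine (pi_norm_le_iff_of_nonneg (norm_nonneg _)).2 fun i => ?_
  have hle : ∀ j, |e j - e' j| ≤ ‖e - e'‖ := fun j => norm_le_pi_norm (e - e') j
  rw [Pi.sub_apply, Real.norm_eq_abs]
  by_cases hi : i ∈ S
  · simpa only [relax_source hi] using hle i
  · rw [relax_of_notMem hi, relax_of_notMem hi, sub_sub_sub_cancel_right]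
    refine abs_nbrMin_sub_le (norm_nonneg _) fun j hj => ?_
    rw [add_sub_add_right_eq_sub, Pi.add_apply, Pi.add_apply, add_sub_add_left_eq_sub]
    exact hle j

lemma norm_relax_zero_le [Fintype V] (hG : G.Connected) (hS : S.Nonempty) (hw : ∀ d, 0 < w d)
    {u : G.Dart → ℝ} {D : ℝ} (hD : 0 ≤ D) (hu : ∀ d, |u d| ≤ D) : ‖relax G w S 0 u‖ ≤ D := by
  refine (pi_norm_le_iff_of_nonneg hD).2 fun i => ?_
  rw [Real.norm_eq_abs]
  by_cases hi : i ∈ S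
  · simpa [relax_source hi] using hD
  · rw [relax_of_notMem hi, add_zero]
    rw [← nbrMin_dist hG hS hw hi]
    refine abs_nbrMin_sub_le hD fun j hj => ?_
    simpa using hu ⟨(i, j), hj⟩

lemma measurable_relax [Fintype V] {e : ℝ → V → ℝ} (he : Measurable e) {u : ℝ → G.Dart → ℝ}
    (hu : Measurable u) : Measurable fun t => relax G w S (e t) (u t) := by
  refine measurable_pi_lambda _ fun i => ?_
  have he' : ∀ j, Measurable fun t => e t j := fun j => (measurable_pi_apply j).comp he
  have hu' : ∀ d, Measurable fun t => u t d := fun d => (measurable_pi_apply d).comp hu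
  by_cases hi : i ∈ S
  · simpa only [relax_source hi] using he' i
  · simp only [relax_of_notMem hi, nbrMin, Pi.add_apply]
    refine Measurable.sub_const (Measurable.iInf fun j => ?_) _
    exact ((he' j).const_add _).add ((hu' _).const_add _)

/-- Contraction estimate for the weights `σ`: on the admissible states the protocol contracts
`max_i σ_i⁻¹ |e_i|` by `ρ`, up to the size of the perturbation. -/
lemma abs_relax_le [Finite V] (hG : G.Connected) (hS : S.Nonempty) (hw : ∀ d, 0 < w d) {ζ : ℝ}
    (hζ0 : 0 < ζ) (hζ1 : ζ < 1)
    (hζ : ∀ d : G.Dart, d.snd ∉ trueParents G w S d.fst →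
      dist G w S d.fst / (dist G w S d.snd + w d) ≤ ζ)
    {σ : V → ℝ} {ρ : ℝ} (hσ : ∀ i, 0 < σ i) (hρ : 0 < ρ)
    (hpar : ∀ i j, dist G w S j < dist G w S i → σ j ≤ ρ * σ i)
    (hall : ∀ i j, ζ * σ j ≤ ρ * σ i)
    {e : V → ℝ} (he : e ∈ errorStates G w S) {u : G.Dart → ℝ} {r D : ℝ}
    (hr : ∀ i, |e i| ≤ σ i * r) (hr0 : 0 ≤ r) (hD : 0 ≤ D) (hu : ∀ d, |u d| ≤ D)
    (hpos : ∀ d, 0 ≤ w d + u d) (i : V) : |relax G w S e u i| ≤ σ i * (ρ * r) + D := by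
  have hnn : 0 ≤ σ i * (ρ * r) := mul_nonneg (hσ i).le (mul_nonneg hρ.le hr0)
  have hparr : ∀ j, dist G w S j < dist G w S i → σ j * r ≤ σ i * (ρ * r) := fun j hj =>
    (mul_le_mul_of_nonneg_right (hpar i j hj) hr0).trans (le_of_eq (by ring))
  by_cases hi : i ∈ S
  · have h1 := he.2 i hi
    rw [dist_source hw hi, zero_add] at h1
    rw [relax_source hi, h1, abs_zero]
    positivity
  rw [relax_of_notMem hi, abs_le]
  constructor
  · rw [le_sub_iff_add_le']
    refine le_nbrMin (nonempty_neighborSet hG hS hi) fun l hl => ?_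
    have hu1 := (abs_le.1 (hu ⟨(i, l), hl⟩)).1
    have he1 := (abs_le.1 (hr l)).1
    have hwl := hw ⟨(i, l), hl⟩
    simp only [Pi.add_apply]
    by_cases hp : l ∈ trueParents G w S i
    · obtain ⟨-, h', hl'⟩ := hp
      rw [nbrMin_dist hG hS hw hi] at hl'
      have := hparr l (by linarith)
      linarith
    · have h1 := hζ ⟨(i, l), hl⟩ hp
      have hdl := dist_nonneg (S := S) hw l
      rw [div_le_iff₀ (by simpa using add_pos_of_nonneg_of_pos hdl hwl)] at h1
      -- If `d_i ≤ ρ σ_i r`, non-negativity of the perturbed state and weight suffices. Otherwise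
      -- the slack `d_l + w_il - d_i ≥ (1/ζ - 1) d_i ≥ (1/ζ - 1) ρ σ_i r` compensates for `e_l ≥
      -- -σ_l r ≥ -ρ σ_i r / ζ`.
      rcases le_total (dist G w S i) (σ i * (ρ * r)) with hc | hc
      · have := he.1 l
        have := hpos ⟨(i, l), hl⟩
        linarith
      · have h2 : ζ * (σ l * r) ≤ σ i * (ρ * r) := by
          have := mul_le_mul_of_nonneg_right (hall i l) hr0
          linarith
        have h3 : (1 - ζ) * (σ i * (ρ * r)) ≤ (1 - ζ) * dist G w S i :=
          mul_le_mul_of_nonneg_left hc (by linarith)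
        have h4 : ζ * (σ l * r - σ i * (ρ * r)) ≤
            ζ * (dist G w S l + w ⟨(i, l), hl⟩ - dist G w S i) := by
          simp only at h1
          linarith
        have h5 := le_of_mul_le_mul_left h4 hζ0
        linarith
  -- The minimum is at most the value at a single true parent.
  · obtain ⟨p, hp, hpd⟩ := exists_dist_add_eq hG hS hw hi
    have h1 := nbrMin_le (w + u) (dist G w S + e) hp
    simp only [Pi.add_apply] at h1
    have h2 := (abs_le.1 (hu ⟨(i, p), hp⟩)).2
    have h3 := (abs_le.1 (hr p)).2
    have h4 := hparr p (by linarith [hw ⟨(i, p), hp⟩])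
    linarith

/-- An affine function of `d` with values in `[1, 1/ζ)` satisfies all the required inequalities
strictly at `ρ = 1`. They are finitely many, so they survive for some `ρ < 1`. -/
lemma exists_scaling {V : Type*} [Fintype V] {d : V → ℝ} (hd : ∀ i, 0 ≤ d i) {ζ : ℝ} (hζ0 : 0 < ζ)
    (hζ1 : ζ < 1) : ∃ (σ : V → ℝ) (ρ : ℝ), (∀ i, 1 ≤ σ i) ∧ 0 < ρ ∧ ρ < 1 ∧
      (∀ i j, d j < d i → σ j ≤ ρ * σ i) ∧ ∀ i j, ζ * σ j ≤ ρ * σ i := by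
  have hζ' : 0 < 1 / ζ - 1 := sub_pos.2 (one_lt_one_div hζ0 hζ1)
  set M : ℝ := ∑ i, d i + 1 with hM
  have hMpos : 0 < M := add_pos_of_nonneg_of_pos (Finset.sum_nonneg fun i _ => hd i) one_pos
  have hdM : ∀ i, d i / M < 1 := fun i => by
    rw [div_lt_one hMpos, hM]
    have := Finset.single_le_sum (fun i _ => hd i) (Finset.mem_univ i)
    linarith
  set σ : V → ℝ := fun i => 1 + (1 / ζ - 1) * (d i / M) with hσdef
  have hσ1 : ∀ i, 1 ≤ σ i := fun i =>
    le_add_of_nonneg_right (mul_nonneg hζ'.le (div_nonneg (hd i) hMpos.le))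
  have hσpos : ∀ i, 0 < σ i := fun i => one_pos.trans_le (hσ1 i)
  have hσζ : ∀ i, ζ * σ i < 1 := fun i => by
    have h1 : σ i < 1 / ζ := by
      have := mul_lt_mul_of_pos_left (hdM i) hζ'
      simp only [hσdef]; linarith
    rwa [lt_div_iff₀ hζ0, mul_comm] at h1
  have hev : ∀ᶠ ρ : ℝ in 𝓝[<] 1, (∀ i j, d j < d i → σ j ≤ ρ * σ i) ∧
      ∀ i j, ζ * σ j ≤ ρ * σ i := by
    have key : ∀ (a : ℝ) (i : V), a < σ i → ∀ᶠ ρ : ℝ in 𝓝[<] 1, a ≤ ρ * σ i := fun a i ha => by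
      have hc : Tendsto (fun ρ : ℝ => ρ * σ i) (𝓝[<] 1) (𝓝 (1 * σ i)) :=
        (tendsto_id.mul_const (σ i)).mono_left nhdsWithin_le_nhds
      rw [one_mul] at hc
      exact (hc.eventually_const_lt ha).mono fun _ h => h.le
    refine (eventually_all.2 fun i => eventually_all.2 fun j => ?_).and
      (eventually_all.2 fun i => eventually_all.2 fun j => ?_)
    · by_cases hij : d j < d i
      · have : σ j < σ i := by
          simp only [hσdef]
          gcongr
        exact (key _ i this).mono fun _ h _ => h
      · exact Eventually.of_forall fun _ h => absurd h hij
    · exact key _ i ((hσζ j).trans_le (hσ1 i))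
  obtain ⟨ρ, ⟨h1, h2⟩, h3⟩ := (hev.and (Ioo_mem_nhdsLT zero_lt_one)).exists
  exact ⟨σ, ρ, hσ1, h3.1, h3.2, h1, h2⟩

end Relax

end DBMC

namespace DBMC

/-! ### Uniqueness, invariance and existence of solutions -/

section Solutions

variable {V : Type*} {G : SimpleGraph V} {w : G.Dart → ℝ} {S : Set V} {η : ℝ}

lemma isSolution_iff [Fintype V] {u : ℝ → G.Dart → ℝ} {e : ℝ → V → ℝ} :
    IsSolution (errorField G w S η) u e ↔ ContinuousOn e (Ici 0) ∧ ∀ t, 0 ≤ t →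
      IntervalIntegrable (fun s => η • (relax G w S (e s) (u s) - e s)) volume 0 t ∧
        e t = e 0 + ∫ s in (0 : ℝ)..t, η • (relax G w S (e s) (u s) - e s) := by
  simp only [IsSolution, errorField_eq]

/-- The update is nonexpansive in the sup-norm, so the comparison principle with `ρ = 1`, `D = 0`
bounds the difference of two solutions by its initial value `0`. -/
lemma IsSolution.eqOn [Fintype V] (hη : 0 < η) {u : ℝ → G.Dart → ℝ} {e e' : ℝ → V → ℝ}
    (he : IsSolution (errorField G w S η) u e) (he' : IsSolution (errorField G w S η) u e')
    (h0 : e 0 = e' 0) : EqOn e e' (Ici 0) := by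
  rw [isSolution_iff] at he he'
  intro t ht
  have hfun : (fun s => η • ((relax G w S (e s) (u s) - relax G w S (e' s) (u s)) -
      (e s - e' s))) = fun s => η • (relax G w S (e s) (u s) - e s) -
        η • (relax G w S (e' s) (u s) - e' s) := by
    funext s
    rw [← smul_sub, sub_sub_sub_comm]
  have key := sublinear_le_gronwallBound (M := fun x : V → ℝ => ‖x‖) continuous_norm norm_add_le
    (fun c hc x => by rw [norm_smul, Real.norm_eq_abs, abs_of_nonneg hc])
    (ρ := 1) (D := 0) hη (e := fun t => e t - e' t)
    (T := fun t => relax G w S (e t) (u t) - relax G w S (e' t) (u t)) (he.1.sub he'.1)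
    (fun t ht => by
      rw [hfun]
      exact (he.2 t ht).1.sub (he'.2 t ht).1)
    (fun t ht => by
      rw [hfun, intervalIntegral.integral_sub (he.2 t ht).1 (he'.2 t ht).1]
      nth_rw 1 [(he.2 t ht).2, (he'.2 t ht).2]
      abel)
    (fun t _ => by simpa using norm_relax_sub_le (e t) (e' t) (u t)) ht
  have : ‖e t - e' t‖ ≤ 0 := by simpa [gronwallBound_ε0, h0] using key
  exact sub_eq_zero.1 (norm_le_zero_iff.1 this)

/-- With non-negative weights the update does not increase the largest negative part of the state,
so this part stays `0`. -/
lemma IsSolution.mem_errorStates [Fintype V] [Nonempty V] (hG : G.Connected) (hS : S.Nonempty)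
    (hη : 0 < η) {u : ℝ → G.Dart → ℝ} (hu : ∀ t, 0 ≤ t → ∀ d, 0 ≤ w d + u t d) {e : ℝ → V → ℝ}
    (he : IsSolution (errorField G w S η) u e) (h0 : e 0 ∈ errorStates G w S) {t : ℝ}
    (ht : 0 ≤ t) : e t ∈ errorStates G w S := by
  rw [isSolution_iff] at he
  set d := dist G w S with hd
  let M : (V → ℝ) → ℝ := fun x => ⨆ i, max (-x i) 0
  have hle : ∀ (x : V → ℝ) i, max (-x i) 0 ≤ M x := fun x i =>
    le_ciSup (f := fun i => max (-x i) 0) (Set.finite_range _).bddAbove i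
  have hfun : (fun s => η • ((d + relax G w S (e s) (u s)) - (d + e s))) =
      fun s => η • (relax G w S (e s) (u s) - e s) := by
    funext s
    rw [add_sub_add_left_eq_sub]
  have key := sublinear_le_gronwallBound (M := M)
    (continuous_iSup_of_fintype (m := fun i x => max (-x i) 0) fun i => by fun_prop)
    (iSup_add_le (m := fun i x => max (-x i) 0) fun i x y => by
      refine max_le ?_ (add_nonneg (le_max_right _ _) (le_max_right _ _))
      rw [Pi.add_apply, neg_add]
      exact add_le_add (le_max_left _ _) (le_max_left _ _))
    (iSup_smul (m := fun i x => max (-x i) 0) fun i c hc x => by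
      rw [mul_max_of_nonneg _ _ hc, mul_zero, mul_neg, Pi.smul_apply, smul_eq_mul])
    (ρ := 1) (D := 0) hη (e := fun t => d + e t) (T := fun t => d + relax G w S (e t) (u t))
    (continuousOn_const.add he.1)
    (fun t ht => by rw [hfun]; exact (he.2 t ht).1)
    (fun t ht => by
      rw [hfun]
      nth_rw 1 [(he.2 t ht).2]
      rw [add_assoc])
    (fun t ht => by
      rw [one_mul, add_zero]
      refine ciSup_le fun i => max_le ?_ ((le_max_right _ _).trans (hle _ i))
      by_cases hi : i ∈ S
      · rw [Pi.add_apply, relax_source hi]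
        exact (le_max_left _ _).trans (hle (d + e t) i)
      · rw [Pi.add_apply, relax_of_notMem hi, ← hd, add_sub_cancel, neg_le]
        refine le_nbrMin (nonempty_neighborSet hG hS hi) fun j hj => ?_
        have h1 := (le_max_left _ _).trans (hle (d + e t) j)
        have h2 := hu t ht ⟨(i, j), hj⟩
        rw [Pi.add_apply w]
        linarith) ht
  have hM0 : M (d + e 0) ≤ 0 := ciSup_le fun i => max_le (neg_nonpos.2 (h0.1 i)) le_rfl
  have hMt : M (d + e t) ≤ 0 := by
    rw [sub_self, mul_zero, neg_zero, gronwallBound_ε0] at key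
    exact key.trans (mul_nonpos_of_nonpos_of_nonneg hM0 (Real.exp_pos _).le)
  refine ⟨fun i => ?_, fun i hi => ?_⟩
  · have := (le_max_left _ _).trans ((hle (d + e t) i).trans hMt)
    exact neg_nonpos.1 this
  · rw [← h0.2 i hi]
    congr 1
    have heq := (he.2 t ht).2
    -- At a source the field vanishes, so that coordinate of the integral is `0`.
    have hproj := ContinuousLinearMap.intervalIntegral_comp_comm
      (ContinuousLinearMap.proj (R := ℝ) (φ := fun _ : V => ℝ) i) (he.2 t ht).1
    simp only [ContinuousLinearMap.proj_apply, Pi.smul_apply, Pi.sub_apply, relax_source hi,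
      sub_self, smul_zero, intervalIntegral.integral_zero] at hproj
    rw [heq, Pi.add_apply, ← hproj, add_zero]

lemma exists_isSolution [Fintype V] (hG : G.Connected) (hS : S.Nonempty) (hw : ∀ d, 0 < w d)
    (hη : 0 < η) {u : ℝ → G.Dart → ℝ} (hu : Measurable u) {D : ℝ} (hD : 0 ≤ D)
    (huD : ∀ t, 0 ≤ t → ∀ d, |u t d| ≤ D) (e₀ : V → ℝ) :
    ∃ e, IsSolution (errorField G w S η) u e ∧ e 0 = e₀ := by
  -- The input is controlled only for `t ≥ 0`, hence the extension `u (max s 0)`.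
  obtain ⟨e, hec, he⟩ := exists_integral_solution (E := V → ℝ) (K := 2 * η) (B := η * D)
    (f := fun s x => η • (relax G w S x (u (max s 0)) - x)) (by positivity)
    (fun e he => by
      have h1 : Measurable fun s => relax G w S (e s) (u (max s 0)) :=
        measurable_relax he.measurable (hu.comp (by fun_prop))
      exact ((h1.sub he.measurable).const_smul η).aestronglyMeasurable)
    (fun s x y => by
      rw [← smul_sub, norm_smul, Real.norm_eq_abs, abs_of_pos hη, sub_sub_sub_comm, two_mul,
        add_mul, ← mul_add]
      refine mul_le_mul_of_nonneg_left ((norm_sub_le _ _).trans ?_) hη.le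
      gcongr
      exact norm_relax_sub_le _ _ _)
    (fun s => by
      rw [norm_smul, Real.norm_eq_abs, abs_of_pos hη, sub_zero]
      exact mul_le_mul_of_nonneg_left
        (norm_relax_zero_le hG hS hw hD (huD _ (le_max_right _ _))) hη.le) e₀
  have h0 : e 0 = e₀ := by simpa using (he 0 le_rfl).2
  refine ⟨e, isSolution_iff.2 ⟨hec.continuousOn, fun t ht => ?_⟩, h0⟩
  have hcongr : ∀ s ∈ uIcc 0 t, η • (relax G w S (e s) (u (max s 0)) - e s) =
      η • (relax G w S (e s) (u s) - e s) := fun s hs => by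
    rw [uIcc_of_le ht] at hs
    rw [max_eq_left hs.1]
  refine ⟨(he t ht).1.congr fun s hs => hcongr s (uIoc_subset_uIcc hs), ?_⟩
  rw [h0, ← intervalIntegral.integral_congr hcongr]
  exact (he t ht).2

lemma exists_abs_le_of_mem_weightDeviations [Fintype V] {u : ℝ → G.Dart → ℝ}
    (hu : u ∈ weightDeviations G w) : ∃ B, 0 ≤ B ∧ ∀ t, 0 ≤ t → ∀ d, |u t d| ≤ B := by
  classical
  obtain ⟨-, a, b, ha, hab⟩ := hu
  obtain ⟨C, hC⟩ := (Set.finite_range fun d => |w d|).bddAbove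
  refine ⟨|b| + |C|, by positivity, fun t ht d => ?_⟩
  have h1 : |w d| ≤ C := hC ⟨d, rfl⟩
  have h2 := hab t ht d
  have h3 : |w d + u t d| ≤ |b| := abs_le_abs_of_nonneg (ha.le.trans h2.1) h2.2
  have h4 := abs_sub (w d + u t d) (w d)
  rw [add_sub_cancel_left] at h4
  linarith [le_abs_self C]

lemma nonneg_of_mem_weightDeviations {u : ℝ → G.Dart → ℝ}
    (hu : u ∈ weightDeviations G w) {t : ℝ} (ht : 0 ≤ t) (d : G.Dart) : 0 ≤ w d + u t d := by
  obtain ⟨-, a, b, ha, hab⟩ := hu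
  exact ha.le.trans (hab t ht d).1

lemma forwardComplete_errorField [Fintype V] [Nonempty V] (hG : G.Connected) (hS : S.Nonempty)
    (hw : ∀ d, 0 < w d) (hη : 0 < η) :
    ForwardComplete (errorField G w S η) (errorStates G w S) (weightDeviations G w) := by
  intro e₀ he₀ u hu
  obtain ⟨B, hB0, hB⟩ := exists_abs_le_of_mem_weightDeviations hu
  obtain ⟨e, he, h0⟩ := exists_isSolution hG hS hw hη hu.1 hB0 hB e₀
  exact ⟨e, he, h0, fun t ht => he.mem_errorStates hG hS hη
    (fun t ht d => nonneg_of_mem_weightDeviations hu ht d) (h0 ▸ he₀) ht,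
    fun e' he' h0' => he'.eqOn hη he (h0'.trans h0.symm)⟩

end Solutions

end DBMC

/-! ### The Lyapunov function and the ISS estimate -/

theorem mainTheorem1 {V : Type*} [Fintype V] (G : SimpleGraph V) (hG : G.Connected)
    (S : Set V) (hS : S.Nonempty) (hSV : S ≠ Set.univ)
    (w : G.Dart → ℝ) (hw : ∀ d, 0 < w d) (hsymm : ∀ d : G.Dart, w d.symm = w d)
    (NX : Seminorm ℝ (V → ℝ)) (hNX : DBMC.IsMonotonicNorm NX)
    (NU : Seminorm ℝ (G.Dart → ℝ)) (hNU : DBMC.IsMonotonicNorm NU)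
    (ζ : ℝ) (hζ0 : 0 < ζ) (hζ1 : ζ < 1)
    (hζ : ∀ d : G.Dart, d.snd ∉ DBMC.trueParents G w S d.fst →
      DBMC.dist G w S d.fst / (DBMC.dist G w S d.snd + w d) ≤ ζ)
    (η : ℝ) (hη1 : 1 < η) (hη2 : η < 1 / ζ) :
    (∃ σ : V → ℝ, (∀ i, 0 < σ i) ∧
      DBMC.IsEISSLyapunov NX NU (DBMC.errorField G w S η) (DBMC.errorStates G w S)
        (DBMC.weightDeviations G w) (fun e => ⨆ i, (σ i)⁻¹ * |e i|)) ∧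
    DBMC.IsExpISS NX NU (DBMC.errorField G w S η) (DBMC.errorStates G w S)
      (DBMC.weightDeviations G w) := by
  classical
  have hη : 0 < η := one_pos.trans hη1
  have : Nonempty V := hS.to_subtype.map Subtype.val
  obtain ⟨σ, ρ, hσ1, hρ0, hρ1, hpar, hall⟩ :=
    DBMC.exists_scaling (fun i => DBMC.dist_nonneg (S := S) hw i) hζ0 hζ1
  have hσ : ∀ i, 0 < σ i := fun i => one_pos.trans_le (hσ1 i)
  obtain ⟨CX, hCX, hNXle⟩ := hNX.exists_abs_le
  obtain ⟨CU, hCU, hNUle⟩ := hNU.exists_abs_le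
  set M : (V → ℝ) → ℝ := fun e => ⨆ i, (σ i)⁻¹ * |e i| with hM
  have hMc : Continuous M := DBMC.continuous_weightedSup
  have hMadd : ∀ x y, M (x + y) ≤ M x + M y := DBMC.weightedSup_add_le hσ
  have hMsmul : ∀ c : ℝ, 0 ≤ c → ∀ x, M (c • x) = c * M x := DBMC.weightedSup_smul
  have hM0 : ∀ x, 0 ≤ M x := DBMC.weightedSup_nonneg hσ
  have hMabs : ∀ x i, |x i| ≤ σ i * M x := DBMC.abs_le_mul_weightedSup hσ
  have hρ' : 0 < 1 - ρ := sub_pos.2 hρ1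
  have hu : ∀ u ∈ DBMC.weightDeviations G w, ∀ t, 0 ≤ t → ∀ d,
      |u t d| ≤ CU * DBMC.supNorm NU u := fun u hu t ht d => by
    obtain ⟨B, -, hB⟩ := DBMC.exists_abs_le_of_mem_weightDeviations hu
    exact (hNUle (u t) d).trans
      (mul_le_mul_of_nonneg_left (hNU.le_supNorm hB ht) hCU.le)
  have hcontr : ∀ x ∈ DBMC.errorStates G w S, ∀ u ∈ DBMC.weightDeviations G w, ∀ t, 0 ≤ t →
      M (DBMC.relax G w S x (u t)) ≤ ρ * M x + CU * DBMC.supNorm NU u := by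
    intro x hx u hu' t ht
    have hD : 0 ≤ CU * DBMC.supNorm NU u := mul_nonneg hCU.le (DBMC.supNorm_nonneg _ _)
    refine DBMC.weightedSup_le hσ fun i => ?_
    refine (DBMC.abs_relax_le hG hS hw hζ0 hζ1 hζ hσ hρ0 hpar hall hx (hMabs x) (hM0 x) hD
      (hu u hu' t ht) (fun d => DBMC.nonneg_of_mem_weightDeviations hu' ht d) i).trans ?_
    -- Because `1 ≤ σ i`, the input term is not enlarged on division by `σ i`.
    rw [mul_add]
    exact add_le_add_right (le_mul_of_one_le_left hD (hσ1 i)) _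
  have hσN : 0 < NX σ := by
    refine lt_of_le_of_ne (apply_nonneg NX _) fun h => ?_
    obtain ⟨i⟩ := this
    exact (hσ i).ne' (congrFun (hNX.1 _ h.symm) i)
  have hNXM : ∀ x, NX x ≤ NX σ * M x := fun x => by
    have h1 : NX (M x • σ) = NX σ * M x := by
      rw [map_smul_eq_mul, Real.norm_eq_abs, abs_of_nonneg (hM0 x), mul_comm]
    rw [← h1]
    refine hNX.2 _ _ fun i => (hMabs x i).trans ?_
    rw [mul_comm]
    exact le_abs_self _
  have hMNX : ∀ x, M x ≤ CX * NX x := fun x =>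
    DBMC.weightedSup_le hσ fun i => (hNXle x i).trans
      (le_mul_of_one_le_left (mul_nonneg hCX.le (apply_nonneg NX x)) (hσ1 i))
  -- The gain `2 * CU / (1 - ρ)` lets the input consume at most half of the decay `1 - ρ`, which
  -- leaves the rate `η * (1 - ρ) / 2`. The trajectory estimate bypasses the implication form and
  -- keeps the full rate `η * (1 - ρ)`.
  refine ⟨⟨σ, hσ, hMc, hM0, (NX σ)⁻¹, CX, 1, η * ((1 - ρ) / 2), inv_pos.2 hσN, hCX, one_pos,
    by positivity, fun x => ?_, fun r => 2 / (1 - ρ) * CU * r,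
    DBMC.classKInf_const_mul (by positivity), fun x hx u hu' hχ t ht ξ hξ => ?_⟩,
    DBMC.forwardComplete_errorField hG hS hw hη, NX σ * CX, η * (1 - ρ), by positivity,
    by positivity, fun r => NX σ * (CU / (1 - ρ)) * r,
    (DBMC.classKInf_const_mul (by positivity)).1, fun u hu' e he h0 t ht => ?_⟩
  · rw [Real.rpow_one]
    exact ⟨(inv_mul_le_iff₀ hσN).2 (hNXM x), hMNX x⟩
  · have h1 := DBMC.apply_sub_le_of_mem_clarkeGradient hMc
      (DBMC.convexOn_of_sublinear hMadd hMsmul) hξ (DBMC.relax G w S x (u t))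
    have h2 := hcontr x hx u hu' t ht
    have h3 : CU * DBMC.supNorm NU u ≤ (1 - ρ) / 2 * M x := by
      have h4 := mul_le_mul_of_nonneg_left hχ (half_pos hρ').le
      refine le_trans (le_of_eq ?_) h4
      field_simp
    rw [DBMC.errorField_eq, map_smul, smul_eq_mul]
    have h5 : ξ (DBMC.relax G w S x (u t) - x) ≤ -((1 - ρ) / 2 * M x) := by linarith
    calc η * ξ (DBMC.relax G w S x (u t) - x) ≤ η * -((1 - ρ) / 2 * M x) := by gcongr
      _ = -(η * ((1 - ρ) / 2)) * M x := by ring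
  · have hX : ∀ t, 0 ≤ t → e t ∈ DBMC.errorStates G w S := fun t ht =>
      he.mem_errorStates hG hS hη
        (fun t ht d => DBMC.nonneg_of_mem_weightDeviations hu' ht d) h0 ht
    have he' := DBMC.isSolution_iff.1 he
    have key := DBMC.sublinear_le_gronwallBound hMc hMadd hMsmul hη he'.1
      (fun t ht => (he'.2 t ht).1) (fun t ht => (he'.2 t ht).2)
      (fun t ht => hcontr (e t) (hX t ht) u hu' t ht) ht
    set s := DBMC.supNorm NU u
    have hs : 0 ≤ s := DBMC.supNorm_nonneg _ _
    have hbound : M (e t) ≤ M (e 0) * Real.exp (-(η * (1 - ρ)) * t) + CU / (1 - ρ) * s := by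
      refine key.trans ?_
      rw [gronwallBound_of_K_ne_0 (by
        have := mul_pos hη hρ'
        linarith)]
      refine add_le_add_right ?_ _
      -- The forcing term of the Grönwall bound is its limit `CU / (1 - ρ) * s` minus a non-negative
      -- transient, which is dropped.
      have h1 : η * (CU * s) / -(η * (1 - ρ)) * (Real.exp (-(η * (1 - ρ)) * t) - 1) =
          CU / (1 - ρ) * s - CU / (1 - ρ) * s * Real.exp (-(η * (1 - ρ)) * t) := by
        field_simp
        ring
      rw [h1]
      have : 0 ≤ CU / (1 - ρ) * s * Real.exp (-(η * (1 - ρ)) * t) := by positivity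
      linarith
    calc NX (e t) ≤ NX σ * M (e t) := hNXM _
      _ ≤ NX σ * (CX * NX (e 0) * Real.exp (-(η * (1 - ρ)) * t) + CU / (1 - ρ) * s) := by
        gcongr
        refine hbound.trans ?_
        gcongr
        exact hMNX _
      _ = NX σ * CX * Real.exp (-(η * (1 - ρ)) * t) * NX (e 0) +
          NX σ * (CU / (1 - ρ)) * s := by ring
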